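/- Let $v_1,\dots,v_m$ be independent random vectors in $\mathbb{C}^d$, defined on a common probability space, each with finite support (that is, each almost surely takes values in some finite set). Suppose that $\mathbb{E}\sum_{i=1}^m v_i v_i^* \le I_d$, meaning that $I_d-\mathbb{E}\sum_{i=1}^m v_i v_i^*$ is positive semidefinite, and that $\mathbb{E}\|v_i\|^2\le\varepsilon$ for all $i$, where $\|v_i\|$ is the Euclidean norm. Then $$\mathbb{P}\left[\left\|\sum_{i=1}^m v_i v_i^*\right\|\le (1+\sqrt{\varepsilon})^2\right]>0,$$ where the norm of the matrix is its operator norm with respect to the Euclidean norm on $\mathbb{C}^d$. -/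

import Mathlib

open MeasureTheory ProbabilityTheory
-- the norm on square complex matrices is the operator norm induced by the Euclidean norm,
-- and `A ≤ B` between matrices means that `B - A` is positive semidefinite
open scoped Matrix.Norms.L2Operator MatrixOrder

/-- The rank-one matrix `x x^*`, with entries `x a * conj (x b)`. -/
def outerSelf {d : ℕ} (x : EuclideanSpace ℂ (Fin d)) : Matrix (Fin d) (Fin d) ℂ :=
  Matrix.vecMulVec x.ofLp (star x.ofLp)

/-! A function F of matrices that, like `det`, is affine along rank-one directions satisfies F(Z -
vv*) = (1 - D_{vv*})F(Z), D being the directional derivative. By independence the expected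
characteristic polynomial of ∑ v_i v_i^* is therefore the value at x·1 of ∏ (1 - D_{A_i}) det, with
A_i = E v_i v_i^*. It has no root above (1 + √ε)² (`re_mixedDet_pos_of_sqrt`), and some outcome of
positive probability does no worse (`exists_list_re_det_pos`).

Both claims rest on stability: the products that occur do not vanish where the imaginary part is
positive definite. Hence along a positive definite direction D_A F / F is a sum of terms w/(t - a)
with w ≥ 0 and a a real root of F (`LowerHalfPair.exists_partialFractions`).

Selection: these ratios decrease beyond the roots. If every candidate of positive weight failed
somewhere, all would fail at the leftmost failure point, and so would their average.

Root bound: the barrier D_A F / F equals tr A / t ≤ ε/t for F = det at t·1. By convexity of 1/(t -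
a), passing to (1 - D_B)F while moving by δB raises no barrier, provided that of B is at most 1 -
1/δ. The final point is t·1 + δ∑A_i ≤ (t + δ)·1; the choice t = √ε + ε, δ = 1 + √ε gives (1 + √ε)².
-/

/-! ### Real-rooted polynomials and partial fractions -/

section RealRooted

open Polynomial

/-- A real polynomial without zeros in the open upper half plane splits over `ℝ`. -/
theorem splits_of_aeval_ne_zero {q : ℝ[X]}
    (h : ∀ z : ℂ, 0 < z.im → aeval z q ≠ 0) : q.Splits := by
  by_cases hq : q = 0
  · simp [hq]
  refine Splits.of_splits_map (algebraMap ℝ ℂ) (IsAlgClosed.splits _) fun z hz => ?_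
  have hz0 : aeval z q = 0 := by
    rw [mem_roots (by simpa using hq), IsRoot, eval_map_algebraMap] at hz
    exact hz
  rcases lt_trichotomy z.im 0 with hlt | heq | hgt
  · exfalso
    refine h (starRingEnd ℂ z) (by simpa using hlt) ?_
    rw [aeval_conj, hz0, map_zero]
  · exact ⟨z.re, by apply Complex.ext <;> simp [heq]⟩
  · exact absurd hz0 (h z hgt)

/-- The pair `(q, u)` satisfies: `q` has no zeros in the open upper half plane and `u / q` maps it
to the closed lower half plane. -/
def LowerHalfPair (q u : ℝ[X]) : Prop :=
  ∀ z : ℂ, 0 < z.im → aeval z q ≠ 0 ∧ (aeval z u / aeval z q).im ≤ 0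

theorem LowerHalfPair.of_mul {q u : ℝ[X]} {a : ℝ}
    (h : LowerHalfPair ((X - C a) * q) ((X - C a) * u)) : LowerHalfPair q u := by
  intro z hz
  obtain ⟨h1, h2⟩ := h z hz
  rw [map_mul] at h1
  refine ⟨right_ne_zero_of_mul h1, ?_⟩
  rwa [map_mul, map_mul, mul_div_mul_left _ _ (left_ne_zero_of_mul h1)] at h2

/-- Let z = a + re tend to a as r → 0+: the positive factor r^n, which does not affect the sign of
the imaginary part, cancels the pole. -/
theorem LowerHalfPair.im_residue_nonpos {h u : ℝ[X]} {a : ℝ} {n : ℕ}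
    (hp : LowerHalfPair ((X - C a) ^ n * h) u) (hh : h.eval a ≠ 0) (e : ℂ) (he : 0 < e.im) :
    (((u.eval a / h.eval a : ℝ) : ℂ) / e ^ n).im ≤ 0 := by
  set w : ℝ → ℂ := fun r => (aeval ((a : ℂ) + r * e) u / aeval ((a : ℂ) + r * e) h) / e ^ n with hw
  have e0 : e ≠ 0 := by rintro rfl; simp at he
  have hae (p : ℝ[X]) : aeval (a : ℂ) p = ((p.eval a : ℝ) : ℂ) := by
    simpa using aeval_algebraMap_apply_eq_algebraMap_eval (A := ℂ) a p
  have hcont : ContinuousAt w 0 := by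
    refine ContinuousAt.div_const (ContinuousAt.div ?_ ?_ ?_) _
    · exact (u.continuous_aeval.comp (by fun_prop)).continuousAt
    · exact (h.continuous_aeval.comp (by fun_prop)).continuousAt
    · simpa [hae] using hh
  have h0 : w 0 = ((u.eval a / h.eval a : ℝ) : ℂ) / e ^ n := by
    simp [hw, hae]
  rw [← h0]
  have ht : Filter.Tendsto (fun r => (w r).im) (nhdsWithin 0 (Set.Ioi 0)) (nhds (w 0).im) :=
    (Complex.continuous_im.continuousAt.comp hcont).tendsto.mono_left nhdsWithin_le_nhds
  refine le_of_tendsto ht ?_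
  filter_upwards [self_mem_nhdsWithin] with r hr
  have hr : (0 : ℝ) < r := hr
  obtain ⟨_, h2⟩ := hp ((a : ℂ) + r * e) (by simpa using mul_pos hr he)
  have h3 : aeval ((a : ℂ) + r * e) u / aeval ((a : ℂ) + r * e) ((X - C a) ^ n * h)
      = ((r ^ n)⁻¹ : ℝ) * w r := by
    have hr' : (r : ℂ) ≠ 0 := by exact_mod_cast hr.ne'
    simp only [hw, map_mul, map_pow, map_sub, aeval_X, aeval_C, Complex.coe_algebraMap,
      add_sub_cancel_left, mul_pow, Complex.ofReal_inv, Complex.ofReal_pow]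
    field_simp
  rw [h3, Complex.im_ofReal_mul] at h2
  exact nonpos_of_mul_nonpos_right h2 (by positivity)

/-- Near a the quotient behaves like c/(z - a)^n, whose argument turns by nπ over a half circle; it
stays in the lower half plane only if n = 1 and c ≥ 0. -/
theorem LowerHalfPair.simple_root {h u : ℝ[X]} {a : ℝ} {n : ℕ}
    (hp : LowerHalfPair ((X - C a) ^ n * h) u) (hh : h.eval a ≠ 0) (hu : u.eval a ≠ 0)
    (hn : n ≠ 0) : n = 1 ∧ 0 ≤ u.eval a / h.eval a := by
  set c := u.eval a / h.eval a with hc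
  have hc0 : c ≠ 0 := div_ne_zero hu hh
  have hnpos : (0 : ℝ) < n := by positivity
  have key (θ : ℝ) (h1 : 0 < θ) (h2 : θ < Real.pi) :
      ((c : ℂ) / Complex.exp ((n * θ : ℝ) * Complex.I)).im ≤ 0 := by
    have := hp.im_residue_nonpos hh (Complex.exp (θ * Complex.I))
      (by rw [Complex.exp_ofReal_mul_I_im]; exact Real.sin_pos_of_pos_of_lt_pi h1 h2)
    rwa [← Complex.exp_nat_mul, ← mul_assoc, ← Complex.ofReal_natCast, ← Complex.ofReal_mul] at this
  have hsin (φ : ℝ) : ((c : ℂ) / Complex.exp (φ * Complex.I)).im = -(c * Real.sin φ) := by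
    rw [div_eq_mul_inv, ← Complex.exp_neg, ← neg_mul, ← Complex.ofReal_neg, Complex.im_ofReal_mul,
      Complex.exp_ofReal_mul_I_im, Real.sin_neg, mul_neg]
  have hpi := Real.pi_pos
  have hn1 : (1 : ℝ) ≤ n := by exact_mod_cast Nat.one_le_iff_ne_zero.mpr hn
  have hcnn : 0 ≤ c := by
    have := key (Real.pi / 2 / n) (by positivity)
      ((div_le_self (by positivity) hn1).trans_lt (by linarith))
    rw [mul_div_cancel₀ _ hnpos.ne', hsin, Real.sin_pi_div_two] at this
    linarith
  refine ⟨?_, hcnn⟩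
  by_contra hne
  have hn2 : (2 : ℝ) ≤ n := by exact_mod_cast (show 2 ≤ n by omega)
  -- The angle 3π/(2n) is below π exactly because n ≥ 2; it forces c ≤ 0.
  have := key ((Real.pi / 2 + Real.pi) / n) (by positivity)
    (by rw [div_lt_iff₀ hnpos]; nlinarith)
  rw [mul_div_cancel₀ _ hnpos.ne', hsin, Real.sin_add_pi, Real.sin_pi_div_two] at this
  exact hc0 (by linarith)

/-- Partial fraction decomposition: `u / q` is a nonnegative combination of the `1 / (t - a)` with
`a` a root of `q`. -/
theorem LowerHalfPair.exists_partialFractions {q u : ℝ[X]} (hp : LowerHalfPair q u)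
    (hdeg : u.degree < q.degree) :
    ∃ (s : Finset ℝ) (w : ℝ → ℝ), (∀ a, 0 ≤ w a) ∧ (∀ a ∈ s, q.eval a = 0) ∧
      ∀ t, q.eval t ≠ 0 → u.eval t = q.eval t * ∑ a ∈ s, w a * (t - a)⁻¹ := by
  induction hN : q.natDegree generalizing q u with
  | zero =>
    have : u = 0 := by
      rw [natDegree_eq_zero] at hN
      obtain ⟨c, rfl⟩ := hN
      exact degree_eq_bot.mp (Nat.WithBot.lt_zero_iff.mp (hdeg.trans_le degree_C_le))
    exact ⟨∅, 0, by simp, by simp, by simp [this]⟩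
  | succ N ih =>
    have hq0 : q ≠ 0 := by rintro rfl; simp at hN
    by_cases hcom : ∃ a, q.eval a = 0 ∧ u.eval a = 0
    · obtain ⟨a, hqa, hua⟩ := hcom
      obtain ⟨q, rfl⟩ := dvd_iff_isRoot.mpr hqa
      obtain ⟨u, rfl⟩ := dvd_iff_isRoot.mpr hua
      have hq1 : q ≠ 0 := right_ne_zero_of_mul hq0
      obtain ⟨s, w, hw, hs, h⟩ := ih hp.of_mul (by
        by_contra hlt
        exact absurd hdeg (not_lt.mpr (by
          rw [degree_mul, degree_mul]; gcongr; exact not_lt.mp hlt))) (by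
        rw [natDegree_mul (X_sub_C_ne_zero a) hq1, natDegree_X_sub_C] at hN; omega)
      refine ⟨s, w, hw, fun b hb => by simp [hs b hb], fun t ht => ?_⟩
      rw [eval_mul] at ht
      rw [eval_mul, eval_mul, h t (right_ne_zero_of_mul ht)]
      ring
    · push Not at hcom
      have hsplit : q.Splits := splits_of_aeval_ne_zero fun z hz => (hp z hz).1
      have hsimple : ∀ a, q.eval a = 0 → ∃ h : ℝ[X], q = (X - C a) * h ∧ h.eval a ≠ 0 ∧
          0 ≤ u.eval a / h.eval a := by
        intro a ha
        obtain ⟨h, hh, hd⟩ := exists_eq_pow_rootMultiplicity_mul_and_not_dvd q hq0 a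
        have hha : h.eval a ≠ 0 := fun h0 => hd (dvd_iff_isRoot.mpr h0)
        have hn : q.rootMultiplicity a ≠ 0 := ((rootMultiplicity_pos hq0).mpr ha).ne'
        rw [hh] at hp
        obtain ⟨h1, h2⟩ := hp.simple_root hha (hcom a ha) hn
        exact ⟨h, by rw [h1, pow_one] at hh; exact hh, hha, h2⟩
      have hnodup : q.roots.Nodup := by
        rw [Multiset.nodup_iff_count_le_one]
        intro a
        rw [count_roots]
        by_contra! hgt
        have ha : q.eval a = 0 := (rootMultiplicity_pos hq0).mp (by omega)
        obtain ⟨h, hh, hha, -⟩ := hsimple a ha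
        have hdvd : (X - C a) ^ 2 ∣ q := (pow_dvd_pow _ hgt).trans (pow_rootMultiplicity_dvd q a)
        rw [hh, sq] at hdvd
        exact hha (dvd_iff_isRoot.mp ((mul_dvd_mul_iff_left (X_sub_C_ne_zero a)).mp hdvd))
      -- The roots are simple, so q is a constant times their nodal polynomial. As deg u < deg q,
      -- Lagrange interpolation at the roots recovers u; divided by q, it is the partial fraction
      -- expansion.
      set s := q.roots.toFinset with hs
      have hsval : s.val = q.roots := by rw [hs, Multiset.toFinset_val, hnodup.dedup]
      have hqn : q = C q.leadingCoeff * Lagrange.nodal s id := by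
        conv_lhs => rw [hsplit.eq_prod_roots]
        rw [Lagrange.nodal_eq, Finset.prod, hsval]
        rfl
      have hl : q.leadingCoeff ≠ 0 := leadingCoeff_ne_zero.mpr hq0
      have hcard : (s.card : WithBot ℕ) = q.degree := by
        rw [hsplit.degree_eq_card_roots hq0, ← hsval]; rfl
      have hmem (a : ℝ) : a ∈ s ↔ q.eval a = 0 := by
        rw [hs, Multiset.mem_toFinset, mem_roots hq0]; rfl
      refine ⟨s, fun a => if a ∈ s then
        u.eval a / (q.leadingCoeff * (Lagrange.nodal (s.erase a) id).eval a) else 0,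
        fun a => ?_, fun a ha => (hmem a).mp ha, fun t ht => ?_⟩
      · dsimp only
        split_ifs with ha
        · obtain ⟨h, hh, hha, hnn⟩ := hsimple a ((hmem a).mp ha)
          have : h = C q.leadingCoeff * Lagrange.nodal (s.erase a) id := by
            have h2 := hqn
            rw [Lagrange.nodal_eq_mul_nodal_erase ha, id, mul_left_comm] at h2
            exact mul_left_cancel₀ (X_sub_C_ne_zero a) (hh.symm.trans h2)
          rw [this, eval_mul, eval_C] at hnn
          exact hnn
        · exact le_rfl
      · have hu := Lagrange.eq_interpolate (v := id) (s := s) (f := u) (Set.injOn_id _)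
          (by rw [hcard]; exact hdeg)
        have hts : ∀ i ∈ s, t ≠ id i := by
          rintro i hi rfl
          exact ht ((hmem _).mp hi)
        conv_lhs => rw [hu]
        rw [Lagrange.eval_interpolate_not_at_node _ hts]
        have hqt : q.eval t = q.leadingCoeff * (Lagrange.nodal s id).eval t := by
          simpa using congrArg (eval t) hqn
        rw [hqt, mul_comm q.leadingCoeff, mul_assoc, Finset.mul_sum (a := q.leadingCoeff)]
        congr 1
        refine Finset.sum_congr rfl fun a ha => ?_
        dsimp only [id]
        rw [if_pos ha, Lagrange.nodalWeight_eq_eval_nodal_erase_inv]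
        dsimp only [id]
        field_simp

theorem LowerHalfPair.div_nonneg {q u : ℝ[X]} (hp : LowerHalfPair q u)
    (hdeg : u.degree < q.degree) {x : ℝ} (hx : ∀ t, x ≤ t → q.eval t ≠ 0) :
    0 ≤ u.eval x / q.eval x := by
  obtain ⟨s, w, hw, hs, h⟩ := hp.exists_partialFractions hdeg
  rw [h x (hx x le_rfl), mul_div_cancel_left₀ _ (hx x le_rfl)]
  refine Finset.sum_nonneg fun a ha => mul_nonneg (hw a) (inv_nonneg.mpr ?_)
  by_contra hlt
  exact hx a (by linarith) (hs a ha)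

theorem LowerHalfPair.div_antitone {q u : ℝ[X]} (hp : LowerHalfPair q u)
    (hdeg : u.degree < q.degree) {x y : ℝ} (hx : ∀ t, x ≤ t → q.eval t ≠ 0) (hxy : x ≤ y) :
    u.eval y / q.eval y ≤ u.eval x / q.eval x := by
  obtain ⟨s, w, hw, hs, h⟩ := hp.exists_partialFractions hdeg
  rw [h x (hx x le_rfl), mul_div_cancel_left₀ _ (hx x le_rfl), h y (hx y hxy),
    mul_div_cancel_left₀ _ (hx y hxy)]
  refine Finset.sum_le_sum fun a ha => mul_le_mul_of_nonneg_left ?_ (hw a)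
  have : a < x := by
    by_contra hlt
    exact hx a (by linarith) (hs a ha)
  exact inv_anti₀ (by linarith) (by linarith)

/-- The univariate barrier shift. -/
theorem LowerHalfPair.barrier_shift {q u : ℝ[X]} (hp : LowerHalfPair q u)
    (hdeg : u.degree < q.degree) (hx : ∀ t, 0 ≤ t → q.eval t ≠ 0) {δ : ℝ} (hδ : 0 < δ)
    (hb : (derivative q).eval δ / q.eval δ ≤ 1 - 1 / δ) :
    (u.eval δ - (derivative u).eval δ) / (q.eval δ - (derivative q).eval δ)
      ≤ u.eval 0 / q.eval 0 := by
  obtain ⟨s, w, hw, hs, h⟩ := hp.exists_partialFractions hdeg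
  have hqδ : q.eval δ ≠ 0 := hx δ hδ.le
  have hneg : ∀ a ∈ s, a < 0 := fun a ha => by
    by_contra hlt
    exact hx a (by linarith) (hs a ha)
  have hder : (derivative u).eval δ = (derivative q).eval δ * ∑ a ∈ s, w a * (δ - a)⁻¹ +
      q.eval δ * ∑ a ∈ s, w a * (-1 / (δ - a) ^ 2) := by
    refine (u.hasDerivAt δ).unique ?_
    have h1 : HasDerivAt (fun t => q.eval t * ∑ a ∈ s, w a * (t - a)⁻¹)
        ((derivative q).eval δ * ∑ a ∈ s, w a * (δ - a)⁻¹ +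
      q.eval δ * ∑ a ∈ s, w a * (-1 / (δ - a) ^ 2)) δ := by
      refine (q.hasDerivAt δ).mul (HasDerivAt.fun_sum fun a ha => HasDerivAt.const_mul _ ?_)
      exact ((hasDerivAt_id δ).sub_const a).inv (by have := hneg a ha; simp; linarith)
    refine h1.congr_of_eventuallyEq ?_
    filter_upwards [q.continuous.continuousAt.eventually_ne hqδ] with t ht using h t ht
  set σ := (derivative q).eval δ / q.eval δ with hσ
  have hq' : (derivative q).eval δ = q.eval δ * σ := by rw [hσ]; field_simp
  have hinv : 0 < 1 / δ := by positivity
  have h1σ : 0 < 1 - σ := by linarith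
  rw [hder, h δ hqδ, hq', h 0 (hx 0 le_rfl), mul_div_cancel_left₀ _ (hx 0 le_rfl)]
  -- With g = u/q the left side is g(δ) - g'(δ)/(1 - σ), and 1/(1 - σ) ≤ δ. What remains, g(δ) -
  -- δg'(δ) ≤ g(0), is the tangent line inequality for the convex g, checked term by term.
  have e : (q.eval δ * ∑ a ∈ s, w a * (δ - a)⁻¹ - (q.eval δ * σ * ∑ a ∈ s, w a * (δ - a)⁻¹ +
      q.eval δ * ∑ a ∈ s, w a * (-1 / (δ - a) ^ 2))) / (q.eval δ - q.eval δ * σ)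
      = ∑ a ∈ s, w a * (δ - a)⁻¹ + (∑ a ∈ s, w a * (1 / (δ - a) ^ 2)) / (1 - σ) := by
    have : ∑ a ∈ s, w a * (-1 / (δ - a) ^ 2) = -∑ a ∈ s, w a * (1 / (δ - a) ^ 2) := by
      rw [← Finset.sum_neg_distrib]
      exact Finset.sum_congr rfl fun a _ => by ring
    rw [this, show q.eval δ - q.eval δ * σ = q.eval δ * (1 - σ) by ring]
    field_simp
    ring
  rw [e]
  have hle : (∑ a ∈ s, w a * (1 / (δ - a) ^ 2)) / (1 - σ)
      ≤ (∑ a ∈ s, w a * (1 / (δ - a) ^ 2)) * δ := by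
    rw [div_eq_mul_inv]
    refine mul_le_mul_of_nonneg_left ?_ (Finset.sum_nonneg fun a _ => mul_nonneg (hw a)
      (by positivity))
    rw [inv_le_comm₀ h1σ hδ, ← one_div]
    linarith
  refine (add_le_add le_rfl hle).trans ?_
  rw [Finset.sum_mul, ← Finset.sum_add_distrib]
  refine Finset.sum_le_sum fun a ha => ?_
  have ha := hneg a ha
  have key : (δ - a)⁻¹ + 1 / (δ - a) ^ 2 * δ ≤ (0 - a)⁻¹ := by
    have h1 : 0 < δ - a := by linarith
    have h2 : 0 < 0 - a := by linarith
    rw [inv_eq_one_div, inv_eq_one_div, one_div_mul_eq_div, div_add_div _ _ h1.ne' (by positivity),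
      div_le_div_iff₀ (by positivity) h2]
    nlinarith [mul_pos h1 (sq_pos_of_pos hδ)]
  calc w a * (δ - a)⁻¹ + w a * (1 / (δ - a) ^ 2) * δ
      = w a * ((δ - a)⁻¹ + 1 / (δ - a) ^ 2 * δ) := by ring
    _ ≤ w a * (0 - a)⁻¹ := mul_le_mul_of_nonneg_left key (hw a)

/-- Every root is at most x. The bound is quantitative so that positivity survives a limit of
polynomials. -/
theorem pow_sub_le_eval {q : ℝ[X]} (hs : q.Splits) (hm : q.Monic) {x y : ℝ}
    (hx : ∀ t, x < t → q.eval t ≠ 0) (hxy : x ≤ y) : (y - x) ^ q.natDegree ≤ q.eval y := by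
  rw [hs.eval_eq_prod_roots_of_monic hm, hs.natDegree_eq_card_roots, ← Multiset.prod_replicate,
    ← Multiset.map_const']
  refine Multiset.prod_map_le_prod_map₀ _ _ (fun _ _ => by linarith) fun a ha => ?_
  have : a ≤ x := by
    by_contra hlt
    exact hx a (not_le.mp hlt) (by simpa using (mem_roots hm.ne_zero).mp ha)
  linarith

/-- If an average of polynomials with the common interlacing polynomial `r` is positive on
`(c, ∞)`, then one of them is. -/
theorem exists_forall_eval_pos_of_average {ι : Type*} {S : Finset ι} {p : ι → ℝ} {r : ℝ[X]}
    {u : ι → ℝ[X]} (hm : r.Monic) (hp : ∀ i ∈ S, LowerHalfPair r (u i))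
    (hdeg : ∀ i ∈ S, (u i).degree < r.degree) (hp0 : ∀ i ∈ S, 0 ≤ p i) (hp1 : ∑ i ∈ S, p i = 1)
    {c : ℝ} (havg : ∀ x, c < x → 0 < r.eval x - ∑ i ∈ S, p i * (u i).eval x) :
    ∃ i ∈ S, 0 < p i ∧ ∀ x, c < x → 0 < r.eval x - (u i).eval x := by
  have hne : S.Nonempty := by
    by_contra h
    simp [Finset.not_nonempty_iff_eq_empty.mp h] at hp1
  have hsplit : r.Splits := by
    obtain ⟨i, hi⟩ := hne
    exact splits_of_aeval_ne_zero fun z hz => (hp i hi z hz).1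
  have hpos_of (x : ℝ) (hx : ∀ t, x < t → r.eval t ≠ 0) (y : ℝ) (hxy : x < y) : 0 < r.eval y :=
    (pow_pos (sub_pos.mpr hxy) _).trans_le (pow_sub_le_eval hsplit hm hx hxy.le)
  -- At a largest root ρ > c of r every u_i would be nonnegative, being so just to the right of ρ;
  -- the average would then be nonpositive at ρ.
  have hr : ∀ x, c < x → r.eval x ≠ 0 := by
    by_contra! hcon
    obtain ⟨x, hcx, hx⟩ := hcon
    obtain ⟨ρ, hρ, hmax⟩ := r.roots.toFinset.exists_max_image id
      ⟨x, by rw [Multiset.mem_toFinset, mem_roots hm.ne_zero]; exact hx⟩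
    have hmax' : ∀ t, r.eval t = 0 → t ≤ ρ := fun t ht =>
      hmax t (by rw [Multiset.mem_toFinset, mem_roots hm.ne_zero]; exact ht)
    have hρ0 : r.eval ρ = 0 := by
      rwa [Multiset.mem_toFinset, mem_roots hm.ne_zero] at hρ
    have hρt : ∀ t, ρ < t → r.eval t ≠ 0 := fun t ht h0 => absurd (hmax' t h0) (not_le.mpr ht)
    have hu : ∀ i ∈ S, 0 ≤ (u i).eval ρ := by
      intro i hi
      refine ge_of_tendsto (((u i).continuous.tendsto ρ).mono_left
        (nhdsWithin_le_nhds (s := Set.Ioi ρ))) ?_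
      filter_upwards [self_mem_nhdsWithin] with t ht
      have h1 := (hp i hi).div_nonneg (hdeg i hi) (x := t)
        fun t' ht' => hρt t' (lt_of_lt_of_le ht ht')
      have h2 := hpos_of ρ hρt t ht
      rw [div_nonneg_iff] at h1
      rcases h1 with h1 | h1
      · exact h1.1
      · linarith [h1.2]
    have := havg ρ (hcx.trans_le (hmax' x hx))
    rw [hρ0] at this
    linarith [Finset.sum_nonneg fun i hi => mul_nonneg (hp0 i hi) (hu i hi)]
  have hrpos := hpos_of c hr
  by_contra! hcon
  have hbad : ∀ i, ∃ x, c < x ∧ (i ∈ S → 0 < p i → r.eval x - (u i).eval x ≤ 0) := by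
    intro i
    by_cases h : i ∈ S ∧ 0 < p i
    · obtain ⟨x, h1, h2⟩ := hcon i h.1 h.2
      exact ⟨x, h1, fun _ _ => h2⟩
    -- A dummy point for the other indices: the minimum is over all of S, so it too must exceed c.
    · exact ⟨c + 1, by linarith, fun h1 h2 => absurd ⟨h1, h2⟩ h⟩
  choose x hcx hx using hbad
  obtain ⟨j, hj, hmin⟩ := S.exists_min_image x hne
  have h1 : ∀ i ∈ S, p i * r.eval (x j) ≤ p i * (u i).eval (x j) := by
    intro i hi
    rcases (hp0 i hi).eq_or_lt with h0 | h0
    · simp [← h0]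
    refine mul_le_mul_of_nonneg_left ?_ h0.le
    have h2 := (hp i hi).div_antitone (hdeg i hi) (x := x j) (y := x i)
      (fun t ht => hr t ((hcx j).trans_le ht)) (hmin i hi)
    have h3 : 1 ≤ (u i).eval (x i) / r.eval (x i) := by
      rw [le_div_iff₀ (hrpos _ (hcx i))]
      linarith [hx i hi h0]
    have h4 := h3.trans h2
    rw [le_div_iff₀ (hrpos _ (hcx j))] at h4
    linarith
  have h2 := Finset.sum_le_sum h1
  rw [← Finset.sum_mul, hp1, one_mul] at h2
  linarith [havg (x j) (hcx j)]

end RealRooted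

/-! ### Combinations of shifted determinants -/

section DeterminantCombinations

open scoped ComplexOrder

variable {n : Type*} [Fintype n] [DecidableEq n]

open Polynomial in
theorem eval_det_X_smul_add (Z A : Matrix n n ℂ) (t : ℂ) :
    (Matrix.det ((X : ℂ[X]) • A.map C + Z.map C)).eval t = (Z + t • A).det := by
  rw [← coe_evalRingHom, RingHom.map_det]
  congr 1
  ext i j
  simp [mul_comm (A i j), add_comm (Z i j)]

open Polynomial in
theorem finite_setOf_det_add_smul_one_eq_zero (N : Matrix n n ℂ) :
    {t : ℂ | (N + t • (1 : Matrix n n ℂ)).det = 0}.Finite := by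
  set f : ℂ[X] := Matrix.det ((X : ℂ[X]) • (1 : Matrix n n ℂ).map C + N.map C) with hf
  have hf0 : f ≠ 0 := fun h => by
    have := coeff_det_X_add_C_card (1 : Matrix n n ℂ) N
    rw [← hf, h] at this
    simp at this
  refine (f.roots.toFinset.finite_toSet).subset fun t ht => ?_
  have : f.eval t = (N + t • (1 : Matrix n n ℂ)).det := by
    rw [hf, eval_det_X_smul_add]
  simpa [hf0, this] using ht

/-- For invertible N this is the matrix determinant lemma; N + t·1 is singular for finitely many t
only, so continuity gives the rest. -/
theorem det_add_smul_vecMulVec (N : Matrix n n ℂ) (a b : n → ℂ) (y : ℂ) :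
    (N + y • Matrix.vecMulVec a b).det =
      N.det + y * ((N + Matrix.vecMulVec a b).det - N.det) := by
  have hinv : ∀ N : Matrix n n ℂ, N.det ≠ 0 → ∀ y : ℂ,
      (N + y • Matrix.vecMulVec a b).det = N.det * (1 + y * (b ⬝ᵥ N⁻¹.mulVec a)) := by
    intro N hN y
    have hu : IsUnit N.det := isUnit_iff_ne_zero.mpr hN
    have : N + y • Matrix.vecMulVec a b = N * (1 + Matrix.vecMulVec (y • N⁻¹.mulVec a) b) := by
      rw [mul_add, mul_one, Matrix.mul_vecMulVec, Matrix.mulVec_smul, Matrix.mulVec_mulVec,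
        Matrix.mul_nonsing_inv _ hu, Matrix.one_mulVec, Matrix.smul_vecMulVec]
    rw [this, Matrix.det_mul, Matrix.vecMulVec_eq Unit,
      Matrix.det_one_add_replicateCol_mul_replicateRow, dotProduct_smul, smul_eq_mul]
  have hd : Dense {t : ℂ | (N + t • (1 : Matrix n n ℂ)).det = 0}ᶜ :=
    (finite_setOf_det_add_smul_one_eq_zero N).countable.dense_compl ℂ
  have := Continuous.ext_on hd
    (f := fun t : ℂ => ((N + t • (1 : Matrix n n ℂ)) + y • Matrix.vecMulVec a b).det)
    (g := fun t : ℂ => (N + t • (1 : Matrix n n ℂ)).det +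
      y * (((N + t • (1 : Matrix n n ℂ)) + Matrix.vecMulVec a b).det
        - (N + t • (1 : Matrix n n ℂ)).det))
    (Continuous.matrix_det (by fun_prop))
    (by
      refine Continuous.add (Continuous.matrix_det (by fun_prop)) (continuous_const.mul
        (Continuous.sub (Continuous.matrix_det (by fun_prop)) (Continuous.matrix_det (by fun_prop)))))
    (fun t ht => by
      have h1 := hinv _ ht 1
      rw [one_smul] at h1
      dsimp only
      rw [hinv _ ht, h1]
      ring)
  simpa using congrFun this 0

/-- Real linear combinations, of total weight `w`, of the functions `Z ↦ det (Z - C)` with `C`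
Hermitian. -/
inductive DetComb : ℝ → (Matrix n n ℂ → ℂ) → Prop
  | det_sub (C : Matrix n n ℂ) (hC : C.IsHermitian) : DetComb 1 fun Z => (Z - C).det
  | add {a b : ℝ} {F G : Matrix n n ℂ → ℂ} (hF : DetComb a F) (hG : DetComb b G) :
      DetComb (a + b) fun Z => F Z + G Z
  | smul (r : ℝ) {a : ℝ} {F : Matrix n n ℂ → ℂ} (hF : DetComb a F) :
      DetComb (r * a) fun Z => (r : ℂ) * F Z

theorem contDiff_det {k : WithTop ℕ∞} : ContDiff ℂ k (Matrix.det : Matrix n n ℂ → ℂ) := by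
  have hentry (i j : n) : ContDiff ℂ k fun Z : Matrix n n ℂ => Z i j :=
    (LinearMap.toContinuousLinearMap (Matrix.entryLinearMap ℂ ℂ i j)).contDiff
  have : (Matrix.det : Matrix n n ℂ → ℂ) = fun Z => ∑ σ : Equiv.Perm n,
      ((Equiv.Perm.sign σ : ℤ) : ℂ) * ∏ i, Z (σ i) i := by
    funext Z
    exact Matrix.det_apply' Z
  rw [this]
  exact ContDiff.sum fun σ _ => contDiff_const.mul (contDiff_prod fun i _ => hentry _ _)

namespace DetComb

variable {w : ℝ} {F : Matrix n n ℂ → ℂ}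

theorem det : DetComb 1 (Matrix.det : Matrix n n ℂ → ℂ) := by
  simpa using det_sub (0 : Matrix n n ℂ) Matrix.isHermitian_zero

theorem sub {a b : ℝ} {F G : Matrix n n ℂ → ℂ} (hF : DetComb a F) (hG : DetComb b G) :
    DetComb (a - b) fun Z => F Z - G Z := by
  have := hF.add (hG.smul (-1))
  convert this using 1
  · ring
  · funext Z; push_cast; ring

theorem zero : DetComb 0 fun _ : Matrix n n ℂ => (0 : ℂ) := by
  simpa using (det (n := n)).smul 0

theorem sum {ι : Type*} (s : Finset ι) {G : ι → Matrix n n ℂ → ℂ} (h : ∀ i ∈ s, DetComb 0 (G i)) :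
    DetComb 0 fun Z => ∑ i ∈ s, G i Z := by
  classical
  induction s using Finset.induction_on with
  | empty => simpa using zero
  | insert a s ha ih =>
    simp_rw [Finset.sum_insert ha]
    simpa using (h a (by simp)).add (ih fun i hi => h i (by simp [hi]))

theorem comp_add (hF : DetComb w F) {C : Matrix n n ℂ} (hC : C.IsHermitian) :
    DetComb w fun Z => F (Z + C) := by
  induction hF with
  | det_sub C' hC' =>
    convert det_sub (C' - C) (hC'.sub hC) using 1
    funext Z
    abel_nf
  | add _ _ h1 h2 => exact h1.add h2
  | smul r _ h => exact h.smul r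

theorem contDiff (hF : DetComb w F) {k : WithTop ℕ∞} : ContDiff ℂ k F := by
  induction hF with
  | det_sub C hC => exact contDiff_det.comp (contDiff_id.sub contDiff_const)
  | add _ _ h1 h2 => exact h1.add h2
  | smul r _ h => exact contDiff_const.mul h

theorem differentiable (hF : DetComb w F) : Differentiable ℂ F :=
  (hF.contDiff (k := 1)).differentiable one_ne_zero

theorem im_eq_zero (hF : DetComb w F) {M : Matrix n n ℂ} (hM : M.IsHermitian) :
    (F M).im = 0 := by
  induction hF with
  | det_sub C hC =>
    have : star (M - C).det = (M - C).det := by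
      rw [← Matrix.det_conjTranspose, (hM.sub hC).eq]
    exact Complex.conj_eq_iff_im.mp this
  | add _ _ h1 h2 => simp [h1, h2]
  | smul r _ h => simp [h]

open Polynomial in
-- The weight fixes the top coefficient: weight 1 gives full degree in definite directions, weight 0
-- gives a degree drop.
theorem exists_line (hF : DetComb w F) (Z A : Matrix n n ℂ) :
    ∃ f : ℂ[X], (∀ t, f.eval t = F (Z + t • A)) ∧ f.natDegree ≤ Fintype.card n ∧
      f.coeff (Fintype.card n) = w * A.det := by
  induction hF with
  | det_sub C hC =>
    refine ⟨Matrix.det ((X : ℂ[X]) • A.map Polynomial.C + (Z - C).map Polynomial.C), fun t => ?_,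
      natDegree_det_X_add_C_le A (Z - C), ?_⟩
    · rw [eval_det_X_smul_add, sub_add_eq_add_sub]
    · rw [coeff_det_X_add_C_card]; simp
  | add _ _ h1 h2 =>
    obtain ⟨f, hf, hfd, hfc⟩ := h1
    obtain ⟨g, hg, hgd, hgc⟩ := h2
    refine ⟨f + g, fun t => by simp [hf, hg], natDegree_add_le_of_degree_le hfd hgd, ?_⟩
    rw [coeff_add, hfc, hgc]; push_cast; ring
  | smul r _ h =>
    obtain ⟨f, hf, hfd, hfc⟩ := h
    refine ⟨Polynomial.C (r : ℂ) * f, fun t => by simp [hf], (natDegree_C_mul_le _ _).trans hfd, ?_⟩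
    rw [coeff_C_mul, hfc]; push_cast; ring

theorem add_smul_vecMulVec (hF : DetComb w F) (Z : Matrix n n ℂ) (a b : n → ℂ) (y : ℂ) :
    F (Z + y • Matrix.vecMulVec a b) = F Z + y * (F (Z + Matrix.vecMulVec a b) - F Z) := by
  induction hF with
  | det_sub C hC =>
    have := det_add_smul_vecMulVec (Z - C) a b y
    rwa [sub_add_eq_add_sub, sub_add_eq_add_sub] at this
  | add _ _ h1 h2 => dsimp only; rw [h1, h2]; ring
  | smul r _ h => dsimp only; rw [h]; ring

theorem hasDerivAt_line (hF : DetComb w F) (Z A : Matrix n n ℂ) (t : ℂ) :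
    HasDerivAt (fun s : ℂ => F (Z + s • A)) (fderiv ℂ F (Z + t • A) A) t := by
  have h1 : HasDerivAt (fun s : ℂ => Z + s • A) A t := by
    simpa using ((hasDerivAt_id t).smul_const A).const_add Z
  exact (hF.differentiable _).hasFDerivAt.comp_hasDerivAt t h1

theorem fderiv_vecMulVec (hF : DetComb w F) (Z : Matrix n n ℂ) (a b : n → ℂ) :
    fderiv ℂ F Z (Matrix.vecMulVec a b) = F (Z + Matrix.vecMulVec a b) - F Z := by
  have h1 := hF.hasDerivAt_line Z (Matrix.vecMulVec a b) 0
  simp_rw [hF.add_smul_vecMulVec] at h1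
  have h2 : HasDerivAt (fun y : ℂ => F Z + y * (F (Z + Matrix.vecMulVec a b) - F Z))
      (F (Z + Matrix.vecMulVec a b) - F Z) 0 := by
    simpa using ((hasDerivAt_id (0 : ℂ)).mul_const (F (Z + Matrix.vecMulVec a b) - F Z)).const_add
      (F Z)
  simpa using h1.unique h2

theorem sub_vecMulVec (hF : DetComb w F) (Z : Matrix n n ℂ) (a b : n → ℂ) :
    F (Z - Matrix.vecMulVec a b) = F Z - fderiv ℂ F Z (Matrix.vecMulVec a b) := by
  rw [hF.fderiv_vecMulVec, sub_eq_add_neg, ← neg_one_smul ℂ, hF.add_smul_vecMulVec]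
  ring

/-- A is a sum of terms vv*, and each derivative along vv* is a difference F(Z + vv*) - F(Z), in
which the weights cancel. -/
theorem fderiv_posSemidef (hF : DetComb w F) {A : Matrix n n ℂ} (hA : A.PosSemidef) :
    DetComb 0 fun Z => fderiv ℂ F Z A := by
  obtain ⟨m, v, rfl⟩ := Matrix.posSemidef_iff_eq_sum_vecMulVec.mp hA
  simp_rw [map_sum]
  refine sum _ fun i _ => ?_
  simp_rw [hF.fderiv_vecMulVec]
  simpa using (hF.comp_add (Matrix.posSemidef_vecMulVec_self_star (v i)).isHermitian).sub hF

theorem fderiv_fderiv_comm (hF : DetComb w F) (Z A B : Matrix n n ℂ) :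
    fderiv ℂ (fun Y => fderiv ℂ F Y A) Z B = fderiv ℂ (fun Y => fderiv ℂ F Y B) Z A := by
  have hs : IsSymmSndFDerivAt ℂ F Z :=
    (hF.contDiff (k := 2)).contDiffAt.isSymmSndFDerivAt (by simp)
  have hd : DifferentiableAt ℂ (fderiv ℂ F) Z :=
    ((hF.contDiff (k := 2)).fderiv_right (m := 1) le_rfl).differentiable one_ne_zero Z
  rw [fderiv_clm_apply hd (differentiableAt_const A), fderiv_clm_apply hd (differentiableAt_const B)]
  simpa using hs B A

end DetComb

end DeterminantCombinations

/-! ### Stability on the matrix upper half plane -/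

section Stability

open scoped ComplexOrder
open Polynomial

variable {n : Type*} [Fintype n] [DecidableEq n]

theorem exists_map_ofReal_eq {f : ℂ[X]} (h : ∀ t : ℝ, (f.eval (t : ℂ)).im = 0) :
    ∃ q : ℝ[X], q.map (algebraMap ℝ ℂ) = f := by
  have hconj : f.map (starRingEnd ℂ) = f := by
    refine eq_of_infinite_eval_eq _ _ (Set.Infinite.mono (s := Set.range ((↑) : ℝ → ℂ)) ?_
      (Set.infinite_range_of_injective Complex.ofReal_injective))
    rintro _ ⟨t, rfl⟩
    have h1 := eval_map_apply (p := f) (starRingEnd ℂ) (t : ℂ)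
    rw [Complex.conj_ofReal] at h1
    rw [Set.mem_ofPred_eq, h1]
    exact Complex.conj_eq_iff_im.mpr (h t)
  refine (mem_lifts _).mp ((lifts_iff_coeff_lifts _).mpr fun k => ?_)
  have := congrArg (fun p => p.coeff k) hconj
  simp only [coeff_map] at this
  exact ⟨(f.coeff k).re, Complex.conj_eq_iff_re.mp this⟩

theorem DetComb.exists_real_line {w : ℝ} {F : Matrix n n ℂ → ℂ} (hF : DetComb w F)
    {M B : Matrix n n ℂ} (hM : M.IsHermitian) (hB : B.IsHermitian) :
    ∃ q : ℝ[X], (∀ z : ℂ, aeval z q = F (M + z • B)) ∧ q.natDegree ≤ Fintype.card n ∧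
      q.coeff (Fintype.card n) = w * B.det.re := by
  obtain ⟨f, hf, hfd, hfc⟩ := hF.exists_line M B
  obtain ⟨q, rfl⟩ := exists_map_ofReal_eq (f := f) fun t => by
    rw [hf]
    refine hF.im_eq_zero (hM.add ?_)
    rw [Matrix.IsHermitian, Matrix.conjTranspose_smul, hB.eq]
    simp
  refine ⟨q, fun z => by rw [← hf, eval_map_algebraMap], by simpa using hfd, ?_⟩
  have := congrArg Complex.re hfc
  simpa using this

/-- `F` has no zeros on the generalized upper half plane of matrices with positive definite
imaginary part. -/
def HalfPlaneStable (F : Matrix n n ℂ → ℂ) : Prop :=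
  ∀ M N : Matrix n n ℂ, M.IsHermitian → N.PosDef → F (M + Complex.I • N) ≠ 0

/-- A kernel vector x would give x*Mx + i x*Nx = 0 with x*Mx real and x*Nx > 0. -/
theorem halfPlaneStable_det : HalfPlaneStable (Matrix.det : Matrix n n ℂ → ℂ) := by
  intro M N hM hN h0
  obtain ⟨x, hx0, hx⟩ := Matrix.exists_mulVec_eq_zero_iff.mpr h0
  have h1 : star x ⬝ᵥ (M + Complex.I • N).mulVec x = 0 := by rw [hx, dotProduct_zero]
  rw [Matrix.add_mulVec, dotProduct_add, Matrix.smul_mulVec, dotProduct_smul] at h1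
  have h2 : (star x ⬝ᵥ M.mulVec x).im = 0 := hM.im_star_dotProduct_mulVec_self x
  have h3 := hN.dotProduct_mulVec_pos hx0
  rw [Complex.lt_def] at h3
  have h4 := congrArg Complex.im h1
  simp [h2] at h4
  simp [h4] at h3

omit [Fintype n] [DecidableEq n] in
theorem isHermitian_ofReal_smul {B : Matrix n n ℂ} (hB : B.IsHermitian) (t : ℝ) :
    ((t : ℂ) • B).IsHermitian := by
  rw [Matrix.IsHermitian, Matrix.conjTranspose_smul, hB.eq]
  simp

omit [Fintype n] [DecidableEq n] in
theorem add_smul_eq_re_im (M N A : Matrix n n ℂ) (z : ℂ) :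
    M + Complex.I • N + z • A =
      (M + (z.re : ℂ) • A) + Complex.I • (N + (z.im : ℂ) • A) := by
  conv_lhs => rw [← Complex.re_add_im z]
  rw [add_smul, smul_add, smul_smul, mul_comm Complex.I]
  abel

theorem im_multisetSum (s : Multiset ℂ) : s.sum.im = (s.map Complex.im).sum :=
  map_multiset_sum Complex.imAddGroupHom s

/-- Along t ↦ Z + tA, F is a polynomial with all roots y in the open lower half plane, and its
logarithmic derivative at 0 is ∑ 1/(0 - y). The value 1 is excluded so that 1 - D_A preserves
stability. -/
theorem HalfPlaneStable.fderiv_div {w : ℝ} {F : Matrix n n ℂ → ℂ} (hS : HalfPlaneStable F)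
    (hF : DetComb w F) {M N A : Matrix n n ℂ} (hM : M.IsHermitian) (hN : N.PosDef)
    (hA : A.PosSemidef) :
    (fderiv ℂ F (M + Complex.I • N) A / F (M + Complex.I • N)).im ≤ 0 ∧
      fderiv ℂ F (M + Complex.I • N) A / F (M + Complex.I • N) ≠ 1 := by
  set Z := M + Complex.I • N with hZ
  obtain ⟨f, hf, -, -⟩ := hF.exists_line Z A
  have hf0 : f.eval 0 = F Z := by simp [hf]
  have hfd : (derivative f).eval 0 = fderiv ℂ F Z A := by
    have h1 := hF.hasDerivAt_line Z A 0
    rw [zero_smul, add_zero] at h1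
    refine (f.hasDerivAt 0).unique ?_
    simpa only [hf] using h1
  have hne : f.eval 0 ≠ 0 := by rw [hf0]; exact hS M N hM hN
  have hfne : f ≠ 0 := by rintro rfl; simp at hne
  have hroot : ∀ y ∈ f.roots, y.im < 0 := by
    intro y hy
    by_contra! hy0
    have h1 : f.eval y = 0 := (mem_roots hfne).mp hy
    rw [hf, hZ, add_smul_eq_re_im] at h1
    refine hS _ _ (hM.add (isHermitian_ofReal_smul hA.isHermitian _)) (hN.add_posSemidef ?_) h1
    exact hA.smul (by exact_mod_cast hy0)
  rw [← hf0, ← hfd, (IsAlgClosed.splits f).eval_derivative_div_eval_of_ne_zero hne]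
  have him : ∀ y ∈ f.roots, (1 / (0 - y)).im < 0 := by
    intro y hy
    have h1 := hroot y hy
    have h2 : y ≠ 0 := by rintro rfl; simp at h1
    rw [zero_sub, one_div, Complex.inv_im, Complex.neg_im, neg_neg, Complex.normSq_neg]
    exact div_neg_of_neg_of_pos h1 (Complex.normSq_pos.mpr h2)
  rcases Multiset.empty_or_exists_mem f.roots with h0 | ⟨y, hy⟩
  · simp [h0]
  · have hlt : (f.roots.map fun z => 1 / (0 - z)).sum.im < 0 := by
      rw [im_multisetSum, Multiset.map_map, ← Multiset.cons_erase hy, Multiset.map_cons,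
        Multiset.sum_cons]
      refine add_neg_of_neg_of_nonpos (him y hy) ?_
      refine (Multiset.sum_le_card_nsmul _ 0 fun a ha => ?_).trans_eq (smul_zero _)
      obtain ⟨b, hb, rfl⟩ := Multiset.mem_map.mp ha
      exact (him b (Multiset.mem_of_mem_erase hb)).le
    refine ⟨hlt.le, fun h1 => ?_⟩
    rw [h1] at hlt
    simp at hlt

/-- The operator `1 - D_A`, where `D_A` is the directional derivative along `A`. -/
noncomputable def oneSubDeriv (A : Matrix n n ℂ) (F : Matrix n n ℂ → ℂ) (Z : Matrix n n ℂ) : ℂ :=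
  F Z - fderiv ℂ F Z A

theorem DetComb.oneSubDeriv {w : ℝ} {F : Matrix n n ℂ → ℂ} (hF : DetComb w F) {A : Matrix n n ℂ}
    (hA : A.PosSemidef) : DetComb w (oneSubDeriv A F) := by
  have := hF.sub (hF.fderiv_posSemidef hA)
  rwa [sub_zero] at this

theorem HalfPlaneStable.oneSubDeriv {w : ℝ} {F : Matrix n n ℂ → ℂ} (hS : HalfPlaneStable F)
    (hF : DetComb w F) {A : Matrix n n ℂ} (hA : A.PosSemidef) :
    HalfPlaneStable (oneSubDeriv A F) := by
  intro M N hM hN h0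
  refine (hS.fderiv_div hF hM hN hA).2 ?_
  rw [div_eq_one_iff_eq (hS M N hM hN)]
  exact (sub_eq_zero.mp h0).symm

theorem HalfPlaneStable.lowerHalfPair {w : ℝ} {F : Matrix n n ℂ → ℂ} (hS : HalfPlaneStable F)
    (hF : DetComb w F) {M A B : Matrix n n ℂ} (hM : M.IsHermitian) (hB : B.PosDef)
    (hA : A.PosSemidef) {q u : ℝ[X]} (hq : ∀ z : ℂ, aeval z q = F (M + z • B))
    (hu : ∀ z : ℂ, aeval z u = fderiv ℂ F (M + z • B) A) : LowerHalfPair q u := by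
  intro z hz
  have e : M + z • B = (M + (z.re : ℂ) • B) + Complex.I • ((z.im : ℂ) • B) := by
    simpa using add_smul_eq_re_im M 0 B z
  have hH := hM.add (isHermitian_ofReal_smul hB.isHermitian z.re)
  have hP : ((z.im : ℂ) • B).PosDef := hB.smul (by exact_mod_cast hz)
  rw [hq, hu, e]
  exact ⟨hS _ _ hH hP, (hS.fderiv_div hF hH hP hA).1⟩

theorem Matrix.PosDef.re_det_pos {B : Matrix n n ℂ} (hB : B.PosDef) : 0 < B.det.re :=
  (Complex.lt_def.mp hB.det_pos).1

/-- The restrictions of `F` and of its derivative along `A` to a line of positive definite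
direction. -/
theorem HalfPlaneStable.exists_lowerHalfPair {F : Matrix n n ℂ → ℂ} (hS : HalfPlaneStable F)
    (hF : DetComb 1 F) {M B : Matrix n n ℂ} (hM : M.IsHermitian) (hB : B.PosDef) :
    ∃ q : ℝ[X], (∀ z : ℂ, aeval z q = F (M + z • B)) ∧ q.natDegree = Fintype.card n ∧
      q.leadingCoeff = B.det.re ∧ ∀ A : Matrix n n ℂ, A.PosSemidef →
      ∃ u : ℝ[X], (∀ z : ℂ, aeval z u = fderiv ℂ F (M + z • B) A) ∧ u.degree < q.degree ∧
        LowerHalfPair q u := by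
  obtain ⟨q, hq, hqd, hqc⟩ := hF.exists_real_line hM hB.isHermitian
  rw [one_mul] at hqc
  have hdeg : q.natDegree = Fintype.card n :=
    natDegree_eq_of_le_of_coeff_ne_zero hqd (by rw [hqc]; exact hB.re_det_pos.ne')
  have hq0 : q ≠ 0 := by
    rintro rfl
    rw [coeff_zero] at hqc
    exact hB.re_det_pos.ne hqc
  refine ⟨q, hq, hdeg, by rw [leadingCoeff, hdeg, hqc], fun A hA => ?_⟩
  obtain ⟨u, hu, hud, huc⟩ := (hF.fderiv_posSemidef hA).exists_real_line hM hB.isHermitian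
  refine ⟨u, hu, ?_, hS.lowerHalfPair hF hM hB hA hq hu⟩
  rw [degree_eq_natDegree hq0, hdeg, degree_lt_iff_coeff_zero]
  intro m hm
  rcases hm.eq_or_lt with rfl | hlt
  · rw [huc, zero_mul]
  · exact coeff_eq_zero_of_natDegree_lt (hud.trans_lt hlt)

end Stability

/-! ### The barrier argument -/

section Barrier

open scoped ComplexOrder
open Polynomial

variable {n : Type*} [Fintype n] [DecidableEq n]

/-- The Hermitian matrix `M` lies above the roots of `F`. -/
def AboveRoots (F : Matrix n n ℂ → ℂ) (M : Matrix n n ℂ) : Prop :=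
  M.IsHermitian ∧ ∀ N : Matrix n n ℂ, N.PosSemidef → 0 < (F (M + N)).re

/-- The logarithmic derivative of `F` along `A`, as a real number. -/
noncomputable def barrier (A : Matrix n n ℂ) (F : Matrix n n ℂ → ℂ) (M : Matrix n n ℂ) : ℝ :=
  (fderiv ℂ F M A).re / (F M).re

theorem eval_eq_re_of_aeval {q : ℝ[X]} {g : ℂ → ℂ} (h : ∀ z, aeval z q = g z) (t : ℝ) :
    q.eval t = (g t).re := by
  rw [← h]
  have := aeval_algebraMap_apply_eq_algebraMap_eval (A := ℂ) t q
  rw [Complex.coe_algebraMap] at this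
  rw [this, Complex.ofReal_re]

theorem DetComb.aeval_derivative {w : ℝ} {F : Matrix n n ℂ → ℂ} (hF : DetComb w F)
    {M B : Matrix n n ℂ} {q : ℝ[X]} (hq : ∀ z : ℂ, aeval z q = F (M + z • B)) (z : ℂ) :
    aeval z (derivative q) = fderiv ℂ F (M + z • B) B := by
  refine (q.hasDerivAt_aeval z).unique ?_
  simp_rw [hq]
  exact hF.hasDerivAt_line M B z

omit [Fintype n] [DecidableEq n] in
theorem AboveRoots.re_pos_line {F : Matrix n n ℂ → ℂ} {M B : Matrix n n ℂ} (hM : AboveRoots F M)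
    (hB : B.PosSemidef) {t : ℝ} (ht : 0 ≤ t) : 0 < (F (M + (t : ℂ) • B)).re :=
  hM.2 _ (hB.smul (by exact_mod_cast ht))

theorem HalfPlaneStable.barrier_add_le {F : Matrix n n ℂ → ℂ} (hS : HalfPlaneStable F)
    (hF : DetComb 1 F) {M A B : Matrix n n ℂ} (hM : AboveRoots F M) (hB : B.PosDef)
    (hA : A.PosSemidef) : barrier A F (M + B) ≤ barrier A F M := by
  obtain ⟨q, hq, -, -, h⟩ := hS.exists_lowerHalfPair hF hM.1 hB
  obtain ⟨u, hu, hdeg, hp⟩ := h A hA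
  have hq' := eval_eq_re_of_aeval hq
  have := hp.div_antitone hdeg (x := 0) (y := 1)
    (fun t ht => by rw [hq']; exact (hM.re_pos_line hB.posSemidef ht).ne') zero_le_one
  simpa [barrier, hq', eval_eq_re_of_aeval hu] using this

/-- Beyond M + δB the barrier along B remains at most 1 - 1/δ < 1, that is, D_B F < F. -/
theorem AboveRoots.oneSubDeriv {F : Matrix n n ℂ → ℂ} (hS : HalfPlaneStable F)
    (hF : DetComb 1 F) {M B : Matrix n n ℂ} (hM : AboveRoots F M) (hB : B.PosDef)
    {δ : ℝ} (hδ : 0 < δ) (hb : barrier B F M ≤ 1 - 1 / δ) :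
    AboveRoots (oneSubDeriv B F) (M + (δ : ℂ) • B) := by
  refine ⟨hM.1.add (isHermitian_ofReal_smul hB.isHermitian δ), fun N hN => ?_⟩
  have hBN : ((δ : ℂ) • B + N).PosDef := (hB.smul (by exact_mod_cast hδ)).add_posSemidef hN
  have h1 := (hS.barrier_add_le hF hM hBN hB.posSemidef).trans hb
  have h2 := hM.2 _ hBN.posSemidef
  rw [barrier, div_le_iff₀ h2] at h1
  rw [add_assoc, _root_.oneSubDeriv, Complex.sub_re]
  have : 0 < 1 / δ := by positivity
  nlinarith

theorem HalfPlaneStable.barrier_oneSubDeriv_le {F : Matrix n n ℂ → ℂ} (hS : HalfPlaneStable F)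
    (hF : DetComb 1 F) {M A B : Matrix n n ℂ} (hM : AboveRoots F M) (hB : B.PosDef)
    (hA : A.PosSemidef) {δ : ℝ} (hδ : 0 < δ) (hb : barrier B F M ≤ 1 - 1 / δ) :
    barrier A (_root_.oneSubDeriv B F) (M + (δ : ℂ) • B) ≤ barrier A F M := by
  obtain ⟨q, hq, -, -, h⟩ := hS.exists_lowerHalfPair hF hM.1 hB
  obtain ⟨u, hu, hdeg, hp⟩ := h A hA
  have hq' := eval_eq_re_of_aeval hq
  have hdq := eval_eq_re_of_aeval (hF.aeval_derivative hq)
  have hdu := eval_eq_re_of_aeval ((hF.fderiv_posSemidef hA).aeval_derivative hu)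
  have h1 : (derivative q).eval δ / q.eval δ ≤ 1 - 1 / δ := by
    refine le_trans ?_ hb
    rw [hdq, hq']
    have hP : ((δ : ℂ) • B).PosDef := hB.smul (by exact_mod_cast hδ)
    exact hS.barrier_add_le hF hM hP hB.posSemidef
  have h2 := hp.barrier_shift hdeg
    (fun t ht => by rw [hq']; exact (hM.re_pos_line hB.posSemidef ht).ne') hδ h1
  -- Mixed derivatives commute, so D_A(F - D_B F) restricts to u - u' on the line.
  have h3 : fderiv ℂ (_root_.oneSubDeriv B F) (M + (δ : ℂ) • B) A =
      fderiv ℂ F (M + (δ : ℂ) • B) A -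
        fderiv ℂ (fun Y => fderiv ℂ F Y A) (M + (δ : ℂ) • B) B := by
    rw [hF.fderiv_fderiv_comm]
    change fderiv ℂ (fun Y => F Y - fderiv ℂ F Y B) _ A = _
    rw [fderiv_fun_sub (hF.differentiable _)
      ((hF.fderiv_posSemidef hB.posSemidef).differentiable _)]
    rfl
  rw [hdu, hdq, hq', hq', eval_eq_re_of_aeval hu, eval_eq_re_of_aeval hu] at h2
  rw [barrier, h3, _root_.oneSubDeriv, Complex.sub_re, Complex.sub_re]
  simpa [barrier] using h2

/-- The polynomial `∏ (1 - D_A) det`, the product being over the matrices `A` of the list. Its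
value at `x • 1` is the mixed characteristic polynomial. -/
noncomputable def mixedDet (L : List (Matrix n n ℂ)) : Matrix n n ℂ → ℂ :=
  L.foldr oneSubDeriv Matrix.det

theorem mixedDet_cons (A : Matrix n n ℂ) (L : List (Matrix n n ℂ)) :
    mixedDet (A :: L) = oneSubDeriv A (mixedDet L) := rfl

theorem detComb_mixedDet {L : List (Matrix n n ℂ)} (hL : ∀ A ∈ L, A.PosSemidef) :
    DetComb 1 (mixedDet L) := by
  induction L with
  | nil => exact DetComb.det
  | cons A L ih =>
    exact (ih fun B hB => hL B (by simp [hB])).oneSubDeriv (hL A (by simp))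

theorem halfPlaneStable_mixedDet {L : List (Matrix n n ℂ)} (hL : ∀ A ∈ L, A.PosSemidef) :
    HalfPlaneStable (mixedDet L) := by
  induction L with
  | nil => exact halfPlaneStable_det
  | cons A L ih =>
    have hL' : ∀ B ∈ L, B.PosSemidef := fun B hB => hL B (by simp [hB])
    exact (ih hL').oneSubDeriv (detComb_mixedDet hL') (hL A (by simp))

/-- No barrier ever exceeds its initial value, so the condition at M serves every step of the
induction. -/
theorem aboveRoots_mixedDet {L : List (Matrix n n ℂ)} (hL : ∀ A ∈ L, A.PosDef)
    {M : Matrix n n ℂ} (hM : AboveRoots Matrix.det M) {δ : ℝ} (hδ : 0 < δ)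
    (hb : ∀ B ∈ L, barrier B Matrix.det M ≤ 1 - 1 / δ) :
    AboveRoots (mixedDet L) (M + (δ : ℂ) • L.sum) ∧ ∀ A : Matrix n n ℂ, A.PosSemidef →
      barrier A (mixedDet L) (M + (δ : ℂ) • L.sum) ≤ barrier A Matrix.det M := by
  induction L with
  | nil => simpa [mixedDet] using hM
  | cons B L ih =>
    have hL' : ∀ B ∈ L, B.PosDef := fun C hC => hL C (by simp [hC])
    have hL'' : ∀ B ∈ L, B.PosSemidef := fun C hC => (hL' C hC).posSemidef
    have hB : B.PosDef := hL B (by simp)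
    obtain ⟨h1, h2⟩ := ih hL' fun C hC => hb C (by simp [hC])
    have hF := detComb_mixedDet hL''
    have hS := halfPlaneStable_mixedDet hL''
    have hb' := (h2 B hB.posSemidef).trans (hb B (by simp))
    have e : M + (δ : ℂ) • (B :: L).sum = M + (δ : ℂ) • L.sum + (δ : ℂ) • B := by
      rw [List.sum_cons, smul_add]; abel
    rw [e, mixedDet_cons]
    exact ⟨h1.oneSubDeriv hS hF hB hδ hb', fun A hA =>
      (hS.barrier_oneSubDeriv_le hF h1 hB hA hδ hb').trans (h2 A hA)⟩

theorem fderiv_det_smul_one {A : Matrix n n ℂ} (hA : A.PosSemidef) {t : ℂ} (ht : t ≠ 0) :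
    fderiv ℂ Matrix.det (t • (1 : Matrix n n ℂ)) A =
      (t • (1 : Matrix n n ℂ)).det * (A.trace / t) := by
  obtain ⟨m, v, rfl⟩ := Matrix.posSemidef_iff_eq_sum_vecMulVec.mp hA
  simp_rw [map_sum, Matrix.trace_sum, Finset.sum_div, Finset.mul_sum]
  refine Finset.sum_congr rfl fun i _ => ?_
  rw [DetComb.det.fderiv_vecMulVec]
  have : t • (1 : Matrix n n ℂ) + Matrix.vecMulVec (v i) (star (v i)) =
      t • (1 : Matrix n n ℂ) * (1 + Matrix.vecMulVec (t⁻¹ • v i) (star (v i))) := by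
    rw [mul_add, mul_one, Matrix.smul_vecMulVec, Matrix.smul_mul, one_mul, smul_inv_smul₀ ht]
  rw [this, Matrix.det_mul, Matrix.vecMulVec_eq Unit (t⁻¹ • v i),
    Matrix.det_one_add_replicateCol_mul_replicateRow, Matrix.trace_vecMulVec, dotProduct_smul,
    dotProduct_comm, smul_eq_mul]
  ring

theorem barrier_det_smul_one {A : Matrix n n ℂ} (hA : A.PosSemidef) {t : ℝ} (ht : 0 < t) :
    barrier A Matrix.det ((t : ℂ) • (1 : Matrix n n ℂ)) = A.trace.re / t := by
  have ht' : (t : ℂ) ≠ 0 := by exact_mod_cast ht.ne'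
  have hd : ((t : ℂ) • (1 : Matrix n n ℂ)).det = ((t ^ Fintype.card n : ℝ) : ℂ) := by
    rw [Matrix.det_smul, Matrix.det_one, mul_one]; push_cast; rfl
  rw [barrier, fderiv_det_smul_one hA ht', hd, Complex.re_ofReal_mul, Complex.ofReal_re,
    Complex.div_ofReal_re, mul_div_cancel_left₀]
  positivity

theorem re_mixedDet_pos {L : List (Matrix n n ℂ)} (hL : ∀ A ∈ L, A.PosDef) {t x δ ε : ℝ}
    (ht : 0 < t) (hδ : 0 < δ) (htr : ∀ A ∈ L, A.trace.re ≤ ε) (hε : ε / t ≤ 1 - 1 / δ)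
    (hx : (((x - t : ℝ) : ℂ) • (1 : Matrix n n ℂ) - (δ : ℂ) • L.sum).PosDef) :
    0 < (mixedDet L ((x : ℂ) • (1 : Matrix n n ℂ))).re := by
  have ht1 : ((t : ℂ) • (1 : Matrix n n ℂ)).PosDef :=
    Matrix.PosDef.one.smul (by exact_mod_cast ht)
  have habove : ∀ {M : Matrix n n ℂ}, M.PosDef → AboveRoots Matrix.det M := fun hM =>
    ⟨hM.isHermitian, fun N hN => (hM.add_posSemidef hN).re_det_pos⟩
  -- The start x·1 - δ∑A is chosen so that the shifts end at x·1; by `hx` it dominates t·1, where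
  -- the barriers are traces over t.
  have := (aboveRoots_mixedDet hL (habove (ht1.add hx)) hδ fun B hB => by
    refine (halfPlaneStable_det.barrier_add_le DetComb.det (habove ht1) hx
      (hL B hB).posSemidef).trans ?_
    rw [barrier_det_smul_one (hL B hB).posSemidef ht]
    exact (div_le_div_of_nonneg_right (htr B hB) ht.le).trans hε).1.2 0 Matrix.PosSemidef.zero
  convert this using 3
  rw [Complex.ofReal_sub, sub_smul]
  abel

end Barrier

/-! ### Root bound and choice of an outcome -/

section MixedCharacteristicPolynomial

open scoped ComplexOrder
open Polynomial Filter Topology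

variable {n : Type*} [Fintype n] [DecidableEq n]

theorem contDiff_mixedDet_perturb (L : List (Matrix n n ℂ)) :
    ContDiff ℂ ⊤ (Function.uncurry fun (η : ℂ) (Z : Matrix n n ℂ) =>
      mixedDet (L.map fun A => A + η • (1 : Matrix n n ℂ)) Z) := by
  induction L with
  | nil => exact contDiff_det.comp contDiff_snd
  | cons A L ih =>
    have h1 : ContDiff ℂ ⊤ fun p : ℂ × Matrix n n ℂ =>
        fderiv ℂ (fun Z => mixedDet (L.map fun A => A + p.1 • (1 : Matrix n n ℂ)) Z) p.2
          (A + p.1 • (1 : Matrix n n ℂ)) := by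
      refine ContDiff.fderiv_apply (m := ⊤) (n := ⊤)
        (f := fun (p : ℂ × Matrix n n ℂ) Z =>
          mixedDet (L.map fun A => A + p.1 • (1 : Matrix n n ℂ)) Z) ?_ contDiff_snd
        (contDiff_const.add (contDiff_fst.smul contDiff_const)) le_top
      exact ih.comp ((contDiff_fst.comp contDiff_fst).prodMk contDiff_snd)
    exact ih.sub h1

omit [Fintype n] [DecidableEq n] in
theorem sum_map_add_const (L : List (Matrix n n ℂ)) (C : Matrix n n ℂ) :
    (L.map fun A => A + C).sum = L.sum + (L.length : ℂ) • C := by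
  induction L with
  | nil => simp
  | cons A L ih =>
    simp only [List.map_cons, List.sum_cons, ih, List.length_cons, Nat.cast_add, Nat.cast_one,
      add_smul, one_smul]
    abel

theorem HalfPlaneStable.pow_sub_le_re {F : Matrix n n ℂ → ℂ} (hS : HalfPlaneStable F)
    (hF : DetComb 1 F) {x y : ℝ} (hx : ∀ t : ℝ, x < t → 0 < (F ((t : ℂ) • 1)).re) (hxy : x ≤ y) :
    (y - x) ^ Fintype.card n ≤ (F ((y : ℂ) • 1)).re := by
  obtain ⟨q, hq, hd, hl, h⟩ := hS.exists_lowerHalfPair hF Matrix.isHermitian_zero Matrix.PosDef.one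
  obtain ⟨u, -, -, hp⟩ := h 0 Matrix.PosSemidef.zero
  have hq' : ∀ t : ℝ, q.eval t = (F ((t : ℂ) • 1)).re := fun t => by
    simpa using eval_eq_re_of_aeval hq t
  have hm : q.Monic := by rw [Monic, hl]; simp
  rw [← hq', ← hd]
  exact pow_sub_le_eval (splits_of_aeval_ne_zero fun z hz => (hp z hz).1) hm
    (fun t ht => by rw [hq']; exact (hx t ht).ne') hxy

/-- Adding η·1 makes the matrices positive definite, as the barrier argument needs; the lower bound
does not depend on η. -/
theorem pow_sub_le_re_mixedDet_perturb {L : List (Matrix n n ℂ)} (hL : ∀ A ∈ L, A.PosSemidef)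
    {ε r x y η : ℝ} (hr : 0 < r) (htr : ∀ A ∈ L, A.trace.re ≤ ε) (hsum : (1 - L.sum).PosSemidef)
    (hη : 0 < η) (hηε : ε + η * Fintype.card n ≤ r ^ 2)
    (hηx : (1 + r) ^ 2 + (1 + r) * (L.length * η) < x) (hxy : x ≤ y) :
    (y - x) ^ Fintype.card n ≤ (mixedDet (L.map fun A => A + (η : ℂ) • (1 : Matrix n n ℂ))
      ((y : ℂ) • (1 : Matrix n n ℂ))).re := by
  have hη1 : ((η : ℂ) • (1 : Matrix n n ℂ)).PosDef :=
    Matrix.PosDef.one.smul (by exact_mod_cast hη)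
  have hPD : ∀ A ∈ L.map (fun A => A + (η : ℂ) • (1 : Matrix n n ℂ)), A.PosDef := by
    intro A hA
    obtain ⟨B, hB, rfl⟩ := List.mem_map.mp hA
    exact hη1.posSemidef_add (hL B hB)
  have hPS := fun A hA => (hPD A hA).posSemidef
  refine (halfPlaneStable_mixedDet hPS).pow_sub_le_re (detComb_mixedDet hPS) (fun s hs => ?_) hxy
  -- Here r²/t = r/(1 + r) = 1 - 1/δ and t + δ = (1 + r)².
  refine re_mixedDet_pos hPD (t := r + r ^ 2) (δ := 1 + r) (ε := r ^ 2) (by positivity)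
    (by positivity) ?_ ?_ ?_
  · intro A hA
    obtain ⟨B, hB, rfl⟩ := List.mem_map.mp hA
    rw [Matrix.trace_add, Matrix.trace_smul, Matrix.trace_one]
    have := htr B hB
    simp
    linarith
  · apply le_of_eq
    field_simp
    ring
  · rw [sum_map_add_const]
    have e : ((s - (r + r ^ 2) : ℝ) : ℂ) • (1 : Matrix n n ℂ) - ((1 + r : ℝ) : ℂ) •
        (L.sum + (L.length : ℂ) • (η : ℂ) • (1 : Matrix n n ℂ)) =
        ((1 + r : ℝ) : ℂ) • (1 - L.sum) +
          ((s - (1 + r) ^ 2 - (1 + r) * (L.length * η) : ℝ) : ℂ) • (1 : Matrix n n ℂ) := by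
      rw [smul_add, smul_sub, smul_smul, smul_smul]
      have : ((s - (1 + r) ^ 2 - (1 + r) * (L.length * η) : ℝ) : ℂ) =
        ((s - (r + r ^ 2) : ℝ) : ℂ) - ((1 + r : ℝ) : ℂ) * ((L.length : ℂ) * (η : ℂ)) -
          ((1 + r : ℝ) : ℂ) := by push_cast; ring
      rw [this, sub_smul, sub_smul, mul_assoc]
      abel
    rw [e]
    refine Matrix.PosDef.posSemidef_add (hsum.smul ?_) (Matrix.PosDef.one.smul ?_)
    · exact_mod_cast (by positivity : (0 : ℝ) ≤ 1 + r)
    · exact_mod_cast (by linarith : 0 < s - (1 + r) ^ 2 - (1 + r) * (L.length * η))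

/-- The largest root of the mixed characteristic polynomial is at most `(1 + √ε) ^ 2`. -/
theorem re_mixedDet_pos_of_sqrt {L : List (Matrix n n ℂ)} (hL : ∀ A ∈ L, A.PosSemidef)
    {ε y : ℝ} (hε : 0 ≤ ε) (htr : ∀ A ∈ L, A.trace.re ≤ ε) (hsum : (1 - L.sum).PosSemidef)
    (hy : (1 + √ε) ^ 2 < y) : 0 < (mixedDet L ((y : ℂ) • (1 : Matrix n n ℂ))).re := by
  have hr0 : 0 ≤ √ε := Real.sqrt_nonneg ε
  obtain ⟨x, hx1, hxy⟩ := exists_between hy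
  -- Taking r > √ε leaves room for the trace of η·1 and keeps t positive when ε = 0.
  obtain ⟨r, hr1, hr2⟩ : ∃ r, √ε < r ∧ (1 + r) ^ 2 < x := by
    have hc : ContinuousAt (fun r : ℝ => (1 + r) ^ 2) √ε := by fun_prop
    have h1 := (hc.eventually (gt_mem_nhds hx1)).filter_mono
      (nhdsWithin_le_nhds (s := Set.Ioi √ε))
    obtain ⟨r, h2, h3⟩ := (h1.and self_mem_nhdsWithin).exists
    exact ⟨r, h3, h2⟩
  have hr : 0 < r := hr0.trans_lt hr1
  have hεr : ε < r ^ 2 := by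
    rw [← Real.sq_sqrt hε]
    exact pow_lt_pow_left₀ hr1 hr0 two_ne_zero
  have hcont : Continuous fun η : ℝ => (mixedDet (L.map fun A => A + (η : ℂ) • (1 : Matrix n n ℂ))
      ((y : ℂ) • (1 : Matrix n n ℂ))).re :=
    Complex.continuous_re.comp ((contDiff_mixedDet_perturb L).continuous.comp
      (Complex.continuous_ofReal.prodMk continuous_const))
  have hlim := (hcont.tendsto 0).mono_left (nhdsWithin_le_nhds (s := Set.Ioi (0 : ℝ)))
  have hev : ∀ᶠ η : ℝ in 𝓝[>] (0 : ℝ), (y - x) ^ Fintype.card n ≤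
      (mixedDet (L.map fun A => A + (η : ℂ) • (1 : Matrix n n ℂ))
        ((y : ℂ) • (1 : Matrix n n ℂ))).re := by
    have h1 : ∀ᶠ η : ℝ in 𝓝 (0 : ℝ), ε + η * Fintype.card n < r ^ 2 := by
      have hc : ContinuousAt (fun η : ℝ => ε + η * Fintype.card n) 0 := by fun_prop
      exact hc.eventually (gt_mem_nhds (by simpa using hεr))
    have h2 : ∀ᶠ η : ℝ in 𝓝 (0 : ℝ), (1 + r) ^ 2 + (1 + r) * (L.length * η) < x := by
      have hc : ContinuousAt (fun η : ℝ => (1 + r) ^ 2 + (1 + r) * (L.length * η)) 0 := by fun_prop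
      exact hc.eventually (gt_mem_nhds (by simpa using hr2))
    filter_upwards [h1.filter_mono nhdsWithin_le_nhds, h2.filter_mono nhdsWithin_le_nhds,
      self_mem_nhdsWithin] with η h1 h2 h3
    exact pow_sub_le_re_mixedDet_perturb hL hr htr hsum h3 h1.le h2 hxy.le
  have := ge_of_tendsto hlim hev
  simp only [Complex.ofReal_zero, zero_smul, add_zero, List.map_id'] at this
  exact (pow_pos (sub_pos.mpr hxy) _).trans_le this

/-- One step of the interlacing families argument. -/
theorem exists_re_mixedDet_sub_pos {V : Type*} {S : Finset V} {p : V → ℝ} {ξ : V → n → ℂ}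
    {L : List (Matrix n n ℂ)} (hL : ∀ A ∈ L, A.PosSemidef) (hp : ∀ s ∈ S, 0 ≤ p s)
    (hp1 : ∑ s ∈ S, p s = 1) {C : Matrix n n ℂ} (hC : C.IsHermitian) {c : ℝ}
    (h : ∀ x : ℝ, c < x → 0 < (mixedDet
      ((∑ s ∈ S, (p s : ℂ) • Matrix.vecMulVec (ξ s) (star (ξ s))) :: L) ((x : ℂ) • 1 - C)).re) :
    ∃ s ∈ S, 0 < p s ∧ ∀ x : ℝ, c < x →
      0 < (mixedDet L ((x : ℂ) • 1 - (C + Matrix.vecMulVec (ξ s) (star (ξ s))))).re := by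
  have hF := detComb_mixedDet hL
  obtain ⟨q, hq, -, hl, hu⟩ := (halfPlaneStable_mixedDet hL).exists_lowerHalfPair hF hC.neg
    Matrix.PosDef.one
  have e (z : ℂ) : -C + z • (1 : Matrix n n ℂ) = z • 1 - C := by abel
  simp_rw [e] at hq hu
  choose! u hu1 hu2 hu3 using hu
  have hps (s : V) : (Matrix.vecMulVec (ξ s) (star (ξ s))).PosSemidef :=
    Matrix.posSemidef_vecMulVec_self_star (ξ s)
  obtain ⟨s, hs, hps0, hpos⟩ := exists_forall_eval_pos_of_average (S := S) (p := p) (r := q)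
    (u := fun s => u (Matrix.vecMulVec (ξ s) (star (ξ s)))) (c := c) (by rw [Monic, hl]; simp)
    (fun s _ => hu3 _ (hps s)) (fun s _ => hu2 _ (hps s)) hp hp1 fun x hx => by
      have h1 := h x hx
      rw [mixedDet_cons, oneSubDeriv, map_sum, Complex.sub_re, Complex.re_sum] at h1
      rw [eval_eq_re_of_aeval hq]
      simpa [eval_eq_re_of_aeval (hu1 _ (hps _))] using h1
  refine ⟨s, hs, hps0, fun x hx => ?_⟩
  have h1 := hpos x hx
  rw [eval_eq_re_of_aeval hq, eval_eq_re_of_aeval (hu1 _ (hps s)), ← Complex.sub_re] at h1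
  rwa [← sub_sub, hF.sub_vecMulVec]

/-- The vectors are chosen one at a time; C accumulates the outer products already fixed. -/
theorem exists_list_re_det_pos {V : Type*} {S : Finset V} {ξ : V → n → ℂ} {P : List (V → ℝ)}
    (hp : ∀ p ∈ P, ∀ s ∈ S, 0 ≤ p s) (hp1 : ∀ p ∈ P, ∑ s ∈ S, p s = 1)
    {C : Matrix n n ℂ} (hC : C.IsHermitian) {c : ℝ}
    (h : ∀ x : ℝ, c < x → 0 < (mixedDet
      (P.map fun p => ∑ s ∈ S, (p s : ℂ) • Matrix.vecMulVec (ξ s) (star (ξ s)))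
        ((x : ℂ) • 1 - C)).re) :
    ∃ l : List V, List.Forall₂ (fun p s => s ∈ S ∧ 0 < p s) P l ∧ ∀ x : ℝ, c < x →
      0 < ((x : ℂ) • 1 - (C + (l.map fun s => Matrix.vecMulVec (ξ s) (star (ξ s))).sum)).det.re := by
  induction P generalizing C with
  | nil => exact ⟨[], .nil, by simpa [mixedDet] using h⟩
  | cons p P ih =>
    have hL : ∀ A ∈ P.map fun p => ∑ s ∈ S, (p s : ℂ) • Matrix.vecMulVec (ξ s) (star (ξ s)),
        A.PosSemidef := by
      intro A hA
      obtain ⟨p', hp', rfl⟩ := List.mem_map.mp hA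
      refine Matrix.posSemidef_sum _ fun s hs => (Matrix.posSemidef_vecMulVec_self_star (ξ s)).smul ?_
      exact_mod_cast hp p' (by simp [hp']) s hs
    obtain ⟨s, hs, hps, h1⟩ := exists_re_mixedDet_sub_pos hL (hp p (by simp)) (hp1 p (by simp)) hC h
    obtain ⟨l, hl, h2⟩ := ih (fun p' hp' => hp p' (by simp [hp'])) (fun p' hp' => hp1 p' (by simp [hp']))
      (hC.add (Matrix.posSemidef_vecMulVec_self_star (ξ s)).isHermitian) h1
    refine ⟨s :: l, .cons ⟨hs, hps⟩ hl, fun x hx => ?_⟩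
    have := h2 x hx
    rwa [add_assoc] at this

end MixedCharacteristicPolynomial

/-! ### Operator norms and finitely supported vectors -/

section FiniteSupport

open scoped ComplexOrder

/-- The norm of a positive semidefinite matrix is an eigenvalue, where the determinant vanishes. -/
theorem Matrix.PosSemidef.l2_opNorm_le_of_re_det_pos {n : Type*} [Fintype n] [DecidableEq n]
    {A : Matrix n n ℂ} (hA : A.PosSemidef) {c : ℝ} (hc : 0 ≤ c)
    (h : ∀ x : ℝ, c < x → 0 < ((x : ℂ) • 1 - A).det.re) : ‖A‖ ≤ c := by
  rcases subsingleton_or_nontrivial (Matrix n n ℂ) with hs | hs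
  · rwa [Subsingleton.elim A 0, norm_zero]
  by_contra! hlt
  have h1 : ‖A‖ ∈ spectrum ℝ A :=
    CStarAlgebra.norm_mem_spectrum_of_nonneg (Matrix.nonneg_iff_posSemidef.mpr hA)
  have h2 : algebraMap ℝ (Matrix n n ℂ) ‖A‖ = ((‖A‖ : ℝ) : ℂ) • 1 := by
    rw [Algebra.algebraMap_eq_smul_one, Complex.coe_smul]
  rw [spectrum.mem_iff, h2, Matrix.isUnit_iff_isUnit_det, isUnit_iff_ne_zero, not_not] at h1
  have := h _ hlt
  rw [h1] at this
  simp at this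

theorem posSemidef_outerSelf {d : ℕ} (x : EuclideanSpace ℂ (Fin d)) :
    (outerSelf x).PosSemidef :=
  Matrix.posSemidef_vecMulVec_self_star x.ofLp

theorem trace_outerSelf {d : ℕ} (x : EuclideanSpace ℂ (Fin d)) :
    (outerSelf x).trace = ((‖x‖ ^ 2 : ℝ) : ℂ) := by
  rw [outerSelf, Matrix.trace_vecMulVec, EuclideanSpace.norm_sq_eq, dotProduct]
  push_cast
  exact Finset.sum_congr rfl fun i _ => by simp [Complex.mul_conj, Complex.normSq_eq_norm_sq]

/-- Existence of a good outcome for finitely supported independent rank-one matrices, given by the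
weights `p i` on the common finite support `S`. -/
theorem exists_norm_sum_outerSelf_le {d m : ℕ} {S : Finset (EuclideanSpace ℂ (Fin d))}
    {p : Fin m → EuclideanSpace ℂ (Fin d) → ℝ} (hp : ∀ i, ∀ s ∈ S, 0 ≤ p i s)
    (hp1 : ∀ i, ∑ s ∈ S, p i s = 1) {ε : ℝ} (hsum : ∑ i, ∑ s ∈ S, p i s • outerSelf s ≤ 1)
    (hnorm : ∀ i, ∑ s ∈ S, p i s * ‖s‖ ^ 2 ≤ ε) :
    ∃ s : Fin m → EuclideanSpace ℂ (Fin d), (∀ i, 0 < p i (s i)) ∧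
      ‖∑ i, outerSelf (s i)‖ ≤ (1 + √ε) ^ 2 := by
  -- With m = 0 nothing prevents ε < 0; the real square root is then 0.
  have hε : √ε = √(max ε 0) := by
    rcases le_total 0 ε with h | h
    · rw [max_eq_left h]
    · rw [max_eq_right h, Real.sqrt_eq_zero_of_nonpos h, Real.sqrt_zero]
  set L := (List.ofFn p).map fun q => ∑ s ∈ S, (q s : ℂ) • outerSelf s with hLdef
  have hL : L = List.ofFn fun i => ∑ s ∈ S, (p i s : ℂ) • outerSelf s := by
    rw [hLdef, List.map_ofFn]; rfl
  have hmem : ∀ A ∈ L, ∃ i, A = ∑ s ∈ S, (p i s : ℂ) • outerSelf s := by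
    intro A hA
    rw [hL, List.mem_ofFn] at hA
    obtain ⟨i, hi⟩ := hA
    exact ⟨i, hi.symm⟩
  have hLpos : ∀ A ∈ L, A.PosSemidef := by
    intro A hA
    obtain ⟨i, rfl⟩ := hmem A hA
    refine Matrix.posSemidef_sum _ fun s hs => (posSemidef_outerSelf s).smul ?_
    exact_mod_cast hp i s hs
  have htr : ∀ A ∈ L, A.trace.re ≤ max ε 0 := by
    intro A hA
    obtain ⟨i, rfl⟩ := hmem A hA
    refine le_trans (le_of_eq ?_) ((hnorm i).trans (le_max_left ε 0))
    simp_rw [Matrix.trace_sum, Matrix.trace_smul, trace_outerSelf, smul_eq_mul,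
      ← Complex.ofReal_mul, Complex.re_sum, Complex.ofReal_re]
  have hLsum : (1 - L.sum).PosSemidef := by
    rw [hL, List.sum_ofFn, ← Matrix.le_iff]
    simpa only [Complex.coe_smul] using hsum
  obtain ⟨l, hl, hdet⟩ := exists_list_re_det_pos (S := S) (ξ := fun s => s.ofLp)
    (P := List.ofFn p) (C := 0) (c := (1 + √ε) ^ 2)
    (fun q hq => by obtain ⟨i, rfl⟩ := List.mem_ofFn.mp hq; exact hp i)
    (fun q hq => by obtain ⟨i, rfl⟩ := List.mem_ofFn.mp hq; exact hp1 i)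
    Matrix.isHermitian_zero (fun x hx => by
      rw [sub_zero]
      rw [hε] at hx
      exact re_mixedDet_pos_of_sqrt hLpos (le_max_right ε 0) htr hLsum hx)
  obtain ⟨hlen, hget⟩ := List.forall₂_iff_get.mp hl
  rw [List.length_ofFn] at hlen
  refine ⟨fun i => l.get (i.cast hlen), fun i => ?_, ?_⟩
  · simpa using (hget i (by simp) (by omega)).2
  · have e : (l.map fun s => Matrix.vecMulVec s.ofLp (star s.ofLp)).sum =
        ∑ i : Fin m, outerSelf (l.get (i.cast hlen)) := by
      rw [← List.sum_ofFn]
      congr 1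
      refine List.ext_getElem (by simp [hlen]) fun k h1 h2 => ?_
      simp [outerSelf]
    simp_rw [zero_add, e] at hdet
    exact (Matrix.posSemidef_sum _ fun i _ =>
      posSemidef_outerSelf _).l2_opNorm_le_of_re_det_pos (by positivity) hdet

variable {Ω V E : Type*} [MeasurableSpace Ω] {P : Measure Ω} [IsFiniteMeasure P]
  [MeasurableSpace V] [MeasurableSingletonClass V] [NormedAddCommGroup E] [NormedSpace ℝ E]

omit [NormedSpace ℝ E] [IsFiniteMeasure P] [MeasurableSpace V] [MeasurableSingletonClass V] in
theorem ae_eq_sum_indicator {v : Ω → V} {S : Finset V} (hS : ∀ᵐ ω ∂P, v ω ∈ S) (g : V → E) :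
    (fun ω => g (v ω)) =ᵐ[P] fun ω => ∑ s ∈ S, (v ⁻¹' {s}).indicator (fun _ => g s) ω := by
  filter_upwards [hS] with ω hω
  rw [Finset.sum_eq_single (v ω)]
  · simp
  · intro s _ hs
    exact Set.indicator_of_notMem (fun h => hs h.symm) _
  · exact fun h => absurd hω h

omit [NormedSpace ℝ E] in
theorem integrable_comp_of_finite_support {v : Ω → V} (hv : Measurable v) {S : Finset V}
    (hS : ∀ᵐ ω ∂P, v ω ∈ S) (g : V → E) : Integrable (fun ω => g (v ω)) P :=
  (integrable_finsetSum _ fun s _ =>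
    (integrable_const (g s)).indicator (hv (measurableSet_singleton s))).congr
      (ae_eq_sum_indicator hS g).symm

theorem integral_comp_of_finite_support [CompleteSpace E] {v : Ω → V} (hv : Measurable v)
    {S : Finset V} (hS : ∀ᵐ ω ∂P, v ω ∈ S) (g : V → E) :
    ∫ ω, g (v ω) ∂P = ∑ s ∈ S, P.real (v ⁻¹' {s}) • g s := by
  rw [integral_congr_ae (ae_eq_sum_indicator hS g), integral_finsetSum _ fun s _ =>
    (integrable_const (g s)).indicator (hv (measurableSet_singleton s))]
  exact Finset.sum_congr rfl fun s _ =>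
    integral_indicator_const (g s) (hv (measurableSet_singleton s))

end FiniteSupport

theorem theorem1 {Ω : Type*} [MeasurableSpace Ω] (P : Measure Ω) [IsProbabilityMeasure P]
    (d m : ℕ) (ε : ℝ) (v : Fin m → Ω → EuclideanSpace ℂ (Fin d))
    (hmeas : ∀ i, Measurable (v i))
    (hindep : iIndepFun v P)
    (hfin : ∀ i, ∃ S : Set (EuclideanSpace ℂ (Fin d)), S.Finite ∧ ∀ᵐ ω ∂P, v i ω ∈ S)
    (hsum : ∫ ω, ∑ i, outerSelf (v i ω) ∂P ≤ 1)
    (hnorm : ∀ i, ∫ ω, ‖v i ω‖ ^ 2 ∂P ≤ ε) :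
    0 < P {ω | ‖∑ i, outerSelf (v i ω)‖ ≤ (1 + √ε) ^ 2} := by
  classical
  choose T hTfin hT using hfin
  set S : Finset (EuclideanSpace ℂ (Fin d)) :=
    Finset.univ.biUnion fun i => (hTfin i).toFinset with hSdef
  have hS : ∀ i, ∀ᵐ ω ∂P, v i ω ∈ S := fun i => by
    filter_upwards [hT i] with ω hω
    exact Finset.mem_biUnion.mpr ⟨i, Finset.mem_univ i, (hTfin i).mem_toFinset.mpr hω⟩
  obtain ⟨s, hs, hle⟩ := exists_norm_sum_outerSelf_le (S := S)
    (p := fun i s => P.real (v i ⁻¹' {s})) (ε := ε) (fun _ _ _ => measureReal_nonneg)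
    (fun i => by
      simpa using (integral_comp_of_finite_support (hmeas i) (hS i) fun _ => (1 : ℝ)).symm)
    (by
      rw [integral_finsetSum _ fun i _ =>
        integrable_comp_of_finite_support (hmeas i) (hS i) outerSelf] at hsum
      simpa only [integral_comp_of_finite_support (hmeas _) (hS _) outerSelf] using hsum)
    (fun i => by
      have := hnorm i
      rwa [integral_comp_of_finite_support (hmeas i) (hS i) fun x => ‖x‖ ^ 2] at this)
  -- Independence makes the chosen joint outcome an event of positive probability.
  have hprod : P (⋂ i, v i ⁻¹' {s i}) = ∏ i, P (v i ⁻¹' {s i}) :=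
    hindep.meas_iInter fun i => ⟨{s i}, measurableSet_singleton _, rfl⟩
  have hpos : 0 < P (⋂ i, v i ⁻¹' {s i}) := by
    rw [hprod, pos_iff_ne_zero, Finset.prod_ne_zero_iff]
    intro i _ h0
    have := hs i
    simp [measureReal_def, h0] at this
  refine hpos.trans_le (measure_mono fun ω hω => ?_)
  have hω' : ∀ i, v i ω = s i := fun i => Set.mem_iInter.mp hω i
  change ‖∑ i, outerSelf (v i ω)‖ ≤ (1 + √ε) ^ 2
  simpa only [hω'] using hle
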